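/- Let $p$ be a prime. For $E\subseteq\mathbb Z$ let $\mathrm{Int}(E,\mathbb Z)=\{f\in\mathbb Q[x] : f(E)\subseteq\mathbb Z\}$, and for $n\ge 0$ let $I_n$ be the set consisting of $0$ and the leading coefficients of the elements of $\mathrm{Int}(E,\mathbb Z)$ of degree at most $n$. Let $\alpha_{E,p}(n)=-\nu_p(I_n)=\max\{-\nu_p(a) : a\in I_n,\ a\neq 0\}$, and let $L_{E,p}=\lim_{n\to\infty}\alpha_{E,p}(n)/n$ be the valuative capacity of $E$ with respect to $p$. Let $m\ge 1$ and let $E\subseteq\mathbb Z$ satisfy $E=E'\cup p^mE$, where $p^mE=\{p^mx : x\in E\}$ and $E'=\bigcup_{c\in S}(c+p^m\mathbb Z)$ is a non-empty union of nonzero cosets modulo $p^m$ (that is, $S$ is a non-empty finite list of natural numbers none of which is divisible by $p^m$). Then the valuative capacity $L_{E,p}$ exists as a finite real number and is a root of a polynomial $q_{p,m,S}\in\mathbb Q[x]$ of degree $2$ whose coefficients are recursively computable: they are given by (total) computable functions of the data $(p,m,S)$, the same functions for all $p$, $m$, $S$ and $E$. -/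

import Mathlib

/-- `Int(E, ℤ)`: the polynomials with rational coefficients that take integer values on `E`. -/
def integerValuedPolynomials (E : Set ℤ) : Set (Polynomial ℚ) :=
  {f | ∀ x ∈ E, ∃ y : ℤ, f.eval (x : ℚ) = (y : ℚ)}

/-- The `n`-th characteristic ideal of `E`, as a set of rational numbers: `0` together with the
leading coefficients of the elements of `Int(E, ℤ)` of degree at most `n`. -/
def characteristicIdeal (E : Set ℤ) (n : ℕ) : Set ℚ :=
  {a | a = 0 ∨ ∃ f ∈ integerValuedPolynomials E, f.natDegree ≤ n ∧ f.leadingCoeff = a}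

/-- `α` is the characteristic sequence of `E` with respect to `p`: for every `n`, the integer `α n`
is the negative of the `p`-adic valuation of the `n`-th characteristic ideal `I`. The valuation of
`I` is the least valuation of a nonzero element of `I`, so its negative is the greatest element of
`{-ν_p(a) | a ∈ I, a ≠ 0}`. -/
def IsCharacteristicSequence (p : ℕ) (E : Set ℤ) (α : ℕ → ℤ) : Prop :=
  ∀ n : ℕ, IsGreatest {k : ℤ | ∃ a ∈ characteristicIdeal E n, a ≠ 0 ∧ k = -padicValRat p a} (α n)

/-- `L` is the valuative capacity of `E` with respect to `p`: the characteristic sequence `α` of `E`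
exists (no characteristic ideal has valuation `-∞`), and `α n / n` tends to `L`. -/
def IsValuativeCapacity (p : ℕ) (E : Set ℤ) (L : ℝ) : Prop :=
  ∃ α : ℕ → ℤ, IsCharacteristicSequence p E α ∧
    Filter.Tendsto (fun n : ℕ => (α n : ℝ) / (n : ℝ)) Filter.atTop (nhds L)

/-- The union of the cosets `c + N ℤ`, where `c` runs through the list `S`. -/
def cosetUnion (N : ℕ) (S : List ℕ) : Set ℤ :=
  {x | ∃ c ∈ S, x ≡ (c : ℤ) [ZMOD (N : ℤ)]}

/-- A rational-valued function is computable (recursive) when its numerator and its denominator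
are. -/
def ComputableRat {ι : Type*} [Primcodable ι] (f : ι → ℚ) : Prop :=
  Computable (fun i => (f i).num) ∧ Computable (fun i => (f i).den)

/-! The proof computes the rate `u = 1 / L`, bounded from two sides. A multiset of about `u t`
points whose product of differences is divisible by `p ^ t` on `E` gives, after division by `p ^ t`,
an integer-valued polynomial, hence `α n ≥ t` for `n` about `u t` (`CoverRate`). A subset of `E` of
about `u t` points, each with total valuation at most `t` against the others, gives `α n ≤ t` by
Lagrange interpolation (`PackRate`). If the same `u > 0` is a rate of both kinds, the capacity is `1
/ u` (`isValuativeCapacity_of_rates`).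

Rates are computed on the tree of residue classes, a class modulo `p ^ k` being measured after
removing the valuation `k` common to all differences. Passing from level `k + 1` to `k` adds `1` to
the capacity, which turns `u` into `u / (1 + u)` (`lift`); distinct children of a class have
differences of valuation exactly `k`, so their rates add (`union`). A full class has rate `p - 1`.
At level `m`, the zero class meets `E` in `p ^ m E`, whose rate there is that of `E`. Descending to
level `0` thus gives a self-map of rates `F u = (c + d u) / (a + b u)` with natural coefficients
computed from `(p, m, S)` (`IsSpine`).

The best cover rate `y` satisfies `y ≤ F y` and the best packing rate `z` satisfies `F z ≤ z`. As
`b, c > 0`, `F` has one positive fixed point `u`, and `y ≤ u ≤ z`: so `u` is a rate of both kinds,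
without any prior comparison of `y` with `z`. Rewriting `F u = u` for `L = 1 / u` gives `c L² + (d -
a) L - b = 0`. -/

/-- `x + y / (1 + y)` for fractions `x` and `y`, given as pairs of numerator and denominator. -/
def addLifted (x y : ℕ × ℕ) : ℕ × ℕ :=
  (x.1 * (y.1 + y.2) + y.1 * x.2, x.2 * (y.1 + y.2))

/-- The sum of `y / (1 + y)` over a list of fractions. -/
def liftedSum (l : List (ℕ × ℕ)) : ℕ × ℕ :=
  l.foldl addLifted (0, 1)

/-- The rates of the residue classes modulo `p ^ m` in the union of the classes in `S`. -/
def topRates (D : ℕ × ℕ × List ℕ) : List (ℕ × ℕ) :=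
  (List.range (D.1 ^ D.2.1)).map fun r =>
    if ∃ c ∈ D.2.2, c % (D.1 ^ D.2.1) = r then (D.1 - 1, 1) else (0, 1)

/-- The rates of the residue classes modulo `p ^ k`, from those modulo `p ^ (k + 1)`. -/
def rateStep (p k : ℕ) (U : List (ℕ × ℕ)) : List (ℕ × ℕ) :=
  (List.range (p ^ k)).map fun r =>
    liftedSum ((List.range p).map fun j => U.getD (r + j * p ^ k) (0, 1))

/-- The contribution of the nonzero children of the zero class modulo `p ^ k`. -/
def sideRate (p k : ℕ) (U : List (ℕ × ℕ)) : ℕ × ℕ :=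
  liftedSum ((List.range (p - 1)).map fun j => U.getD ((j + 1) * p ^ k) (0, 1))

/-- Composition of the homography `t = (c + d u) / (a + b u)`, stored as `((c, d), (a, b))`, with
`t ↦ n.1 / n.2 + t / (1 + t)`. -/
def spineStep (n : ℕ × ℕ) (M : (ℕ × ℕ) × (ℕ × ℕ)) : (ℕ × ℕ) × (ℕ × ℕ) :=
  ((n.1 * (M.2.1 + M.1.1) + n.2 * M.1.1, n.1 * (M.2.2 + M.1.2) + n.2 * M.1.2),
    (n.2 * (M.2.1 + M.1.1), n.2 * (M.2.2 + M.1.2)))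

/-- One step from level `m - i` to level `m - i - 1` for `treeState`. -/
def treeNext (D : ℕ × ℕ × List ℕ) (i : ℕ) (s : List (ℕ × ℕ) × ((ℕ × ℕ) × (ℕ × ℕ))) :
    List (ℕ × ℕ) × ((ℕ × ℕ) × (ℕ × ℕ)) :=
  (rateStep D.1 (D.2.1 - 1 - i) s.1, spineStep (sideRate D.1 (D.2.1 - 1 - i) s.1) s.2)

/-- The rates at level `m - i`, with the homography giving the rate of the zero class. -/
def treeState (D : ℕ × ℕ × List ℕ) : ℕ → List (ℕ × ℕ) × ((ℕ × ℕ) × (ℕ × ℕ))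
  | 0 => (topRates D, ((0, 1), (1, 0)))
  | i + 1 => treeNext D i (treeState D i)

/-- The homography for the zero class modulo `p ^ 0`. -/
def rootHomography (D : ℕ × ℕ × List ℕ) : (ℕ × ℕ) × (ℕ × ℕ) :=
  (treeState D D.2.1).2

/-- The quadratic polynomial that vanishes at the capacity. -/
noncomputable def capacityPolynomial (D : ℕ × ℕ × List ℕ) : Polynomial ℚ :=
  Polynomial.C ((rootHomography D).1.1 : ℚ) * Polynomial.X ^ 2 +
    Polynomial.C ((rootHomography D).1.2 - (rootHomography D).2.1 : ℚ) * Polynomial.X +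
    Polynomial.C (-(rootHomography D).2.2 : ℚ)

/-! ### Computability of the coefficients. -/

section Computability

open Primrec

theorem Primrec.nat_pow : Primrec₂ ((· ^ ·) : ℕ → ℕ → ℕ) :=
  Primrec₂.unpaired'.1 Nat.Primrec.pow

theorem primrec_addLifted : Primrec₂ addLifted := by
  have x1 : Primrec fun z : (ℕ × ℕ) × (ℕ × ℕ) => z.1.1 := fst.comp fst
  have x2 : Primrec fun z : (ℕ × ℕ) × (ℕ × ℕ) => z.1.2 := snd.comp fst
  have y1 : Primrec fun z : (ℕ × ℕ) × (ℕ × ℕ) => z.2.1 := fst.comp snd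
  have y2 : Primrec fun z : (ℕ × ℕ) × (ℕ × ℕ) => z.2.2 := snd.comp snd
  have s := nat_add.comp y1 y2
  exact (nat_add.comp (nat_mul.comp x1 s) (nat_mul.comp y1 x2)).pair (nat_mul.comp x2 s)

theorem primrec_liftedSum : Primrec liftedSum :=
  list_foldl .id (.const (0, 1)) (primrec_addLifted.comp₂ (fst.comp₂ .right) (snd.comp₂ .right))

theorem primrec_topRates : Primrec topRates := by
  have hN : Primrec fun D : ℕ × ℕ × List ℕ => D.1 ^ D.2.1 :=
    nat_pow.comp fst (fst.comp snd)
  have hR : PrimrecRel fun (c : ℕ) (z : ℕ × ℕ) => c % z.1 = z.2 :=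
    (Primrec.eq (α := ℕ)).comp (nat_mod.comp fst (fst.comp snd)) (snd.comp snd)
  have hE := hR.exists_mem_list
  have hc : PrimrecPred fun z : (ℕ × ℕ × List ℕ) × ℕ =>
      ∃ c ∈ z.1.2.2, c % (z.1.1 ^ z.1.2.1) = z.2 :=
    hE.comp (snd.comp (snd.comp fst)) ((hN.comp fst).pair snd)
  refine list_map (list_range.comp hN) ?_
  exact ite hc ((nat_sub.comp (fst.comp fst) (.const 1)).pair (.const 1)) (.const (0, 1))

theorem primrec_rateStep :
    Primrec fun z : (ℕ × ℕ) × List (ℕ × ℕ) => rateStep z.1.1 z.1.2 z.2 := by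
  have hN : Primrec fun z : (ℕ × ℕ) × List (ℕ × ℕ) => z.1.1 ^ z.1.2 :=
    nat_pow.comp (fst.comp fst) (snd.comp fst)
  refine list_map (list_range.comp hN) (primrec_liftedSum.comp ?_)
  refine list_map (list_range.comp (fst.comp (fst.comp fst))) ?_
  exact (list_getD (0, 1)).comp (snd.comp (fst.comp fst))
    (nat_add.comp (snd.comp fst) (nat_mul.comp snd (hN.comp (fst.comp fst))))

theorem primrec_sideRate :
    Primrec fun z : (ℕ × ℕ) × List (ℕ × ℕ) => sideRate z.1.1 z.1.2 z.2 := by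
  have hN : Primrec fun z : (ℕ × ℕ) × List (ℕ × ℕ) => z.1.1 ^ z.1.2 :=
    nat_pow.comp (fst.comp fst) (snd.comp fst)
  refine primrec_liftedSum.comp
    (list_map (list_range.comp (nat_sub.comp (fst.comp fst) (.const 1))) ?_)
  exact (list_getD (0, 1)).comp (snd.comp fst)
    (nat_mul.comp (succ.comp snd) (hN.comp fst))

theorem primrec_spineStep : Primrec₂ spineStep := by
  have n1 : Primrec fun z : (ℕ × ℕ) × ((ℕ × ℕ) × (ℕ × ℕ)) => z.1.1 := fst.comp fst
  have n2 : Primrec fun z : (ℕ × ℕ) × ((ℕ × ℕ) × (ℕ × ℕ)) => z.1.2 := snd.comp fst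
  have c : Primrec fun z : (ℕ × ℕ) × ((ℕ × ℕ) × (ℕ × ℕ)) => z.2.1.1 := fst.comp (fst.comp snd)
  have d : Primrec fun z : (ℕ × ℕ) × ((ℕ × ℕ) × (ℕ × ℕ)) => z.2.1.2 := snd.comp (fst.comp snd)
  have a : Primrec fun z : (ℕ × ℕ) × ((ℕ × ℕ) × (ℕ × ℕ)) => z.2.2.1 := fst.comp (snd.comp snd)
  have b : Primrec fun z : (ℕ × ℕ) × ((ℕ × ℕ) × (ℕ × ℕ)) => z.2.2.2 := snd.comp (snd.comp snd)
  have ac := nat_add.comp a c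
  have bd := nat_add.comp b d
  exact ((nat_add.comp (nat_mul.comp n1 ac) (nat_mul.comp n2 c)).pair
    (nat_add.comp (nat_mul.comp n1 bd) (nat_mul.comp n2 d))).pair
    ((nat_mul.comp n2 ac).pair (nat_mul.comp n2 bd))

theorem primrec_treeNext : Primrec₂ fun (D : ℕ × ℕ × List ℕ)
    (q : ℕ × (List (ℕ × ℕ) × ((ℕ × ℕ) × (ℕ × ℕ)))) => treeNext D q.1 q.2 := by
  have hp : Primrec fun z : (ℕ × ℕ × List ℕ) ×
      (ℕ × (List (ℕ × ℕ) × ((ℕ × ℕ) × (ℕ × ℕ)))) => z.1.1 := fst.comp fst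
  have hk : Primrec fun z : (ℕ × ℕ × List ℕ) ×
      (ℕ × (List (ℕ × ℕ) × ((ℕ × ℕ) × (ℕ × ℕ)))) => z.1.2.1 - 1 - z.2.1 :=
    nat_sub.comp (nat_sub.comp (fst.comp (snd.comp fst)) (.const 1)) (fst.comp snd)
  have hU : Primrec fun z : (ℕ × ℕ × List ℕ) ×
      (ℕ × (List (ℕ × ℕ) × ((ℕ × ℕ) × (ℕ × ℕ)))) => z.2.2.1 := fst.comp (snd.comp snd)
  have h := (hp.pair hk).pair hU
  exact (primrec_rateStep.comp h).pair
    (primrec_spineStep.comp (primrec_sideRate.comp h) (snd.comp (snd.comp snd)))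

theorem primrec_treeState : Primrec₂ treeState := by
  have h := nat_rec (primrec_topRates.pair (.const ((0, 1), (1, 0)))) primrec_treeNext
  refine h.of_eq fun D i => ?_
  induction i with
  | zero => rfl
  | succ i ih =>
    rw [treeState, ← ih]

theorem primrec_rootHomography : Primrec rootHomography :=
  snd.comp (primrec_treeState.comp .id (fst.comp snd))

/-- The encoding sends `n` to `2 n` and `-(n + 1)` to `2 n + 1`. This reduces the computability of
an integer difference to truncated subtraction on naturals. -/
theorem encode_natCast_sub (a b : ℕ) :
    Encodable.encode ((a : ℤ) - b) = if b ≤ a then 2 * (a - b) else 2 * (b - a - 1) + 1 := by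
  split_ifs with h
  · obtain ⟨n, rfl⟩ := Nat.exists_eq_add_of_le h
    have e : ((b + n : ℕ) : ℤ) - b = Int.ofNat n := by push_cast; simp
    rw [e, Nat.add_sub_cancel_left]
    rfl
  · obtain ⟨n, rfl⟩ := Nat.exists_eq_add_of_le (Nat.lt_of_not_le h)
    have e : (a : ℤ) - ((a + 1 + n : ℕ) : ℤ) = Int.negSucc n := by
      rw [Int.negSucc_eq]; push_cast; ring
    rw [e, show a + 1 + n - a - 1 = n by omega]
    rfl

theorem Primrec.natCast_sub {ι : Type*} [Primcodable ι] {f g : ι → ℕ} (hf : Primrec f)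
    (hg : Primrec g) : Primrec fun i => (f i : ℤ) - (g i : ℤ) := by
  refine Primrec.encode_iff.1 (Primrec.of_eq ?_ fun i => (encode_natCast_sub (f i) (g i)).symm)
  exact ite (nat_le.comp hg hf) (nat_double.comp (nat_sub.comp hf hg))
    (nat_double_succ.comp (nat_sub.comp (nat_sub.comp hg hf) (.const 1)))

theorem computableRat_natCast_sub {ι : Type*} [Primcodable ι] {f g : ι → ℕ} (hf : Primrec f)
    (hg : Primrec g) : ComputableRat fun i => (f i : ℚ) - (g i : ℚ) := by
  have e : ∀ i, (f i : ℚ) - (g i : ℚ) = (((f i : ℤ) - (g i : ℤ) : ℤ) : ℚ) := by simp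
  simp only [e]
  exact ⟨(Primrec.natCast_sub hf hg).to_comp, Computable.const 1⟩

theorem coeff_capacityPolynomial (D : ℕ × ℕ × List ℕ) (i : ℕ) :
    (capacityPolynomial D).coeff i =
      if i = 0 then -((rootHomography D).2.2 : ℚ) else
      if i = 1 then ((rootHomography D).1.2 : ℚ) - (rootHomography D).2.1 else
      if i = 2 then ((rootHomography D).1.1 : ℚ) else 0 := by
  rcases i with _ | _ | _ | i <;>
    simp [capacityPolynomial, Polynomial.coeff_X, Polynomial.coeff_X_pow]

theorem computableRat_coeff_capacityPolynomial (i : ℕ) :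
    ComputableRat fun D => (capacityPolynomial D).coeff i := by
  have hc := fst.comp (fst.comp primrec_rootHomography)
  have hd := snd.comp (fst.comp primrec_rootHomography)
  have ha := fst.comp (snd.comp primrec_rootHomography)
  have hb := snd.comp (snd.comp primrec_rootHomography)
  have h0 : Primrec fun _ : ℕ × ℕ × List ℕ => 0 := .const 0
  simp only [coeff_capacityPolynomial]
  split_ifs
  · simpa using computableRat_natCast_sub h0 hb
  · exact computableRat_natCast_sub hd ha
  · simpa using computableRat_natCast_sub hc h0
  · simpa using computableRat_natCast_sub h0 h0

end Computability

/-! ### Covering and packing rates: unions and changes of level. -/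

/-- The set `A` is covered at level `k` at the rate `u`: for each `t`, about `u t` points of the class of `r`
modulo `p ^ k` suffice for the product of the differences to gain a valuation `t` at each point of `A`. -/
def CoverRate (p : ℕ) (A : Set ℤ) (r : ℤ) (k : ℕ) (u : ℝ) : Prop :=
  ∀ u' > u, ∃ C : ℝ, ∀ t : ℕ, ∃ P : Multiset ℤ, (∀ y ∈ P, (p : ℤ) ^ k ∣ y - r) ∧
    (P.card : ℝ) ≤ u' * t + C ∧
    ∀ x ∈ A, (p : ℤ) ^ (t + k * P.card) ∣ (P.map fun y => x - y).prod

/-- The set `A` is packed at level `k` at the rate `u`: for each `t`, there are about `u t` points of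
`A` such that the product of the differences of each one with the others gains at most `t`. -/
def PackRate (p : ℕ) (A : Set ℤ) (k : ℕ) (u : ℝ) : Prop :=
  ∀ u' < u, ∃ C : ℝ, ∀ t : ℕ, ∃ Q : Finset ℤ, (∀ x ∈ Q, x ∈ A) ∧
    u' * t - C ≤ Q.card ∧
    ∀ x ∈ Q, ∑ y ∈ Q.erase x, padicValInt p (x - y) ≤ t + k * (Q.erase x).card

namespace CoverRate

variable {p : ℕ} {A B : Set ℤ} {r : ℤ} {k : ℕ} {u v : ℝ}

theorem anti (h : CoverRate p A r k u) (hB : B ⊆ A) (huv : u ≤ v) : CoverRate p B r k v := by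
  intro u' hu'
  obtain ⟨C, hC⟩ := h u' (huv.trans_lt hu')
  refine ⟨C, fun t => ?_⟩
  obtain ⟨P, h1, h2, h3⟩ := hC t
  exact ⟨P, h1, h2, fun x hx => h3 x (hB hx)⟩

/-- The slack `u' > u` in the definition makes the set of rates closed, so an infimum of rates is a
rate. -/
theorem of_forall_gt (h : ∀ v > u, CoverRate p A r k v) : CoverRate p A r k u := by
  intro u' hu'
  obtain ⟨v, hv, hv'⟩ := exists_between hu'
  exact h v hv u' hv'

theorem empty : CoverRate p ∅ r k 0 := by
  intro u' hu'
  refine ⟨0, fun t => ⟨0, by simp, ?_, by simp⟩⟩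
  have : 0 ≤ u' * t := mul_nonneg hu'.le (Nat.cast_nonneg t)
  simpa using this

/-- Each difference gains a factor `p ^ m`, which the shift of level by `m` absorbs exactly. -/
theorem affine (h : CoverRate p A r k u) (c : ℤ) (m : ℕ) :
    CoverRate p ((fun x => c + (p : ℤ) ^ m * x) '' A) (c + (p : ℤ) ^ m * r) (k + m) u := by
  intro u' hu'
  obtain ⟨C, hC⟩ := h u' hu'
  refine ⟨C, fun t => ?_⟩
  obtain ⟨P, h1, h2, h3⟩ := hC t
  refine ⟨P.map fun y => c + (p : ℤ) ^ m * y, ?_, by simpa using h2, ?_⟩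
  · intro y hy
    obtain ⟨z, hz, rfl⟩ := Multiset.mem_map.1 hy
    have e : c + (p : ℤ) ^ m * z - (c + (p : ℤ) ^ m * r) = (z - r) * (p : ℤ) ^ m := by ring
    rw [e, pow_add]
    exact mul_dvd_mul_right (h1 z hz) _
  · rintro _ ⟨x, hx, rfl⟩
    have e : ∀ y : ℤ, c + (p : ℤ) ^ m * x - (c + (p : ℤ) ^ m * y) = (p : ℤ) ^ m * (x - y) :=
      fun y => by ring
    simp only [Multiset.map_map, Function.comp_def, e, Multiset.prod_map_mul, Multiset.map_const',
      Multiset.prod_replicate, Multiset.card_map]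
    rw [show t + (k + m) * P.card = m * P.card + (t + k * P.card) by ring, pow_add, pow_mul]
    exact mul_dvd_mul_left _ (h3 x hx)

/-- The two covers are concatenated: at a point of `A`, every point of the cover of `B` still
contributes at least `k`, the amount discounted at level `k`. -/
theorem union (hA : CoverRate p A r k u) (hB : CoverRate p B r k v)
    (hrA : ∀ x ∈ A, (p : ℤ) ^ k ∣ x - r) (hrB : ∀ x ∈ B, (p : ℤ) ^ k ∣ x - r) :
    CoverRate p (A ∪ B) r k (u + v) := by
  intro w hw
  obtain ⟨C, hC⟩ := hA (u + (w - (u + v)) / 2) (by linarith)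
  obtain ⟨D, hD⟩ := hB (v + (w - (u + v)) / 2) (by linarith)
  refine ⟨C + D, fun t => ?_⟩
  obtain ⟨P, h1, h2, h3⟩ := hC t
  obtain ⟨Q, g1, g2, g3⟩ := hD t
  have key : ∀ (R : Multiset ℤ), (∀ y ∈ R, (p : ℤ) ^ k ∣ y - r) → ∀ x, (p : ℤ) ^ k ∣ x - r →
      (p : ℤ) ^ (k * R.card) ∣ (R.map fun y => x - y).prod := by
    intro R hR x hx
    have h := Multiset.prod_dvd_prod_of_dvd (S := R) (fun _ => (p : ℤ) ^ k) (fun y => x - y)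
      fun y hy => by
        have := dvd_sub hx (hR y hy)
        rwa [sub_sub_sub_cancel_right] at this
    simpa [← pow_mul] using h
  refine ⟨P + Q, ?_, ?_, ?_⟩
  · intro y hy
    exact (Multiset.mem_add.1 hy).elim (h1 y) (g1 y)
  · push_cast [Multiset.card_add]
    linarith
  · rintro x (hx | hx) <;> rw [Multiset.map_add, Multiset.prod_add, Multiset.card_add]
    · rw [show t + k * (P.card + Q.card) = (t + k * P.card) + k * Q.card by ring, pow_add]
      exact mul_dvd_mul (h3 x hx) (key Q g1 x (hrA x hx))
    · rw [show t + k * (P.card + Q.card) = k * P.card + (t + k * Q.card) by ring, pow_add]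
      exact mul_dvd_mul (key P h1 x (hrB x hx)) (g3 x hx)

theorem biUnion {ι : Type*} (s : Finset ι) (F : ι → Set ℤ) (w : ι → ℝ)
    (h : ∀ i ∈ s, CoverRate p (F i) r k (w i)) (hr : ∀ i ∈ s, ∀ x ∈ F i, (p : ℤ) ^ k ∣ x - r) :
    CoverRate p (⋃ i ∈ s, F i) r k (∑ i ∈ s, w i) := by
  classical
  induction s using Finset.induction_on with
  | empty => simpa using CoverRate.empty
  | insert a s ha ih =>
    rw [Finset.set_biUnion_insert, Finset.sum_insert ha]
    refine (h a (by simp)).union (ih (fun i hi => h i (by simp [hi]))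
      fun i hi => hr i (by simp [hi])) (hr a (by simp)) ?_
    intro x hx
    simp only [Set.mem_iUnion] at hx
    obtain ⟨i, hi, hx⟩ := hx
    exact hr i (by simp [hi]) x hx

end CoverRate

theorem exists_gt_div_one_add_le {u v : ℝ} (hu : 0 ≤ u) (h : u / (1 + u) < v) :
    ∃ w > u, w / (1 + w) ≤ v := by
  by_cases hv : 1 ≤ v
  · refine ⟨u + 1, by linarith, ?_⟩
    rw [div_le_iff₀ (by linarith)]
    nlinarith
  · have hv' : 0 < 1 - v := by linarith
    have h0 : 0 < 1 + u := by linarith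
    rw [div_lt_iff₀ h0] at h
    refine ⟨v / (1 - v), ?_, ?_⟩
    · rw [gt_iff_lt, lt_div_iff₀ hv']
      nlinarith
    · have e : 1 + v / (1 - v) = 1 / (1 - v) := by field_simp; ring
      rw [e]
      apply le_of_eq
      field_simp

theorem exists_lt_div_one_add_eq {u v : ℝ} (hv : 0 ≤ v) (hu : 0 ≤ u) (h : v < u / (1 + u)) :
    ∃ w, 0 ≤ w ∧ w < u ∧ w / (1 + w) = v := by
  have h0 : 0 < 1 + u := by linarith
  rw [lt_div_iff₀ h0] at h
  have hv' : 0 < 1 - v := by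
    by_contra hc
    nlinarith
  refine ⟨v / (1 - v), by positivity, ?_, ?_⟩
  · rw [div_lt_iff₀ hv']
    nlinarith
  · have e : 1 + v / (1 - v) = 1 / (1 - v) := by field_simp; ring
    rw [e]
    field_simp

/-- With `N` points, a gain `t'` at level `k + 1` is a gain `t' + N` at level `k`. For `N` about `w
t'`, a gain `t = (1 + w) t'` costs `w t' = w / (1 + w) * t` points. -/
theorem CoverRate.lift {p : ℕ} {A : Set ℤ} {r s : ℤ} {k : ℕ} {u : ℝ}
    (h : CoverRate p A s (k + 1) u) (hu : 0 ≤ u) (hA : ∀ x ∈ A, (p : ℤ) ^ (k + 1) ∣ x - s)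
    (hs : (p : ℤ) ^ k ∣ s - r) : CoverRate p A r k (u / (1 + u)) := by
  intro u' hu'
  obtain ⟨w, hw, hwu⟩ := exists_gt_div_one_add_le hu hu'
  obtain ⟨C, hC⟩ := h w hw
  have hw0 : 0 ≤ w := hu.trans hw.le
  have hw1 : 0 < 1 + w := by linarith
  refine ⟨w + |C| + 1, fun t => ?_⟩
  set t' : ℕ := ⌈(t : ℝ) / (1 + w)⌉₊ with ht'
  have ht1 : (t : ℝ) / (1 + w) ≤ t' := Nat.le_ceil _
  have ht2 : (t' : ℝ) < (t : ℝ) / (1 + w) + 1 := Nat.ceil_lt_add_one (by positivity)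
  obtain ⟨P, h1, h2, h3⟩ := hC t'
  -- `P` may be smaller than `w t'`; `n` copies of `s` pad it, so that `t' + N ≥ (1 + w) t' ≥ t`.
  set n : ℕ := ⌈w * t'⌉₊ - P.card with hn
  have hn1 : w * t' ≤ (P.card : ℝ) + n := by
    have : ⌈w * t'⌉₊ ≤ P.card + n := by omega
    calc w * t' ≤ (⌈w * t'⌉₊ : ℝ) := Nat.le_ceil _
      _ ≤ _ := by exact_mod_cast this
  have hn2 : (P.card : ℝ) + n ≤ w * t' + |C| + 1 := by
    rcases le_total ⌈w * t'⌉₊ P.card with hle | hle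
    · have : n = 0 := by omega
      rw [this]
      have := le_abs_self C
      push_cast
      linarith
    · have : P.card + n = ⌈w * t'⌉₊ := by omega
      have e : (P.card : ℝ) + n = (⌈w * t'⌉₊ : ℝ) := by exact_mod_cast this
      rw [e]
      have := Nat.ceil_lt_add_one (a := w * t') (by positivity)
      have := abs_nonneg C
      linarith
  refine ⟨P + Multiset.replicate n s, ?_, ?_, ?_⟩
  · intro y hy
    rcases Multiset.mem_add.1 hy with hy | hy
    · have := dvd_add ((pow_dvd_pow (p : ℤ) k.le_succ).trans (h1 y hy)) hs
      rwa [sub_add_sub_cancel] at this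
    · rw [Multiset.eq_of_mem_replicate hy]
      exact hs
  · rw [Multiset.card_add, Multiset.card_replicate]
    push_cast
    have e1 : w * t' ≤ w * (t / (1 + w) + 1) := mul_le_mul_of_nonneg_left ht2.le hw0
    have e2 : w / (1 + w) * t ≤ u' * t := mul_le_mul_of_nonneg_right hwu (Nat.cast_nonneg t)
    have e3 : w * (t / (1 + w) + 1) = w / (1 + w) * t + w := by ring
    linarith
  · intro x hx
    rw [Multiset.map_add, Multiset.prod_add, Multiset.card_add, Multiset.card_replicate,
      Multiset.map_replicate, Multiset.prod_replicate]
    have hle : t ≤ t' + (P.card + n) := by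
      have : (t : ℝ) ≤ t' + (P.card + n) := by
        rw [div_le_iff₀ hw1] at ht1
        linarith
      exact_mod_cast this
    have d1 : (p : ℤ) ^ ((k + 1) * n) ∣ (x - s) ^ n := by
      rw [pow_mul]
      exact pow_dvd_pow_of_dvd (hA x hx) n
    refine dvd_trans ?_ (mul_dvd_mul (h3 x hx) d1)
    rw [← pow_add]
    apply pow_dvd_pow
    nlinarith

namespace PackRate

variable {p : ℕ} {A B : Set ℤ} {k : ℕ} {u v : ℝ}

theorem mono (h : PackRate p A k u) (hB : A ⊆ B) (huv : v ≤ u) : PackRate p B k v := by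
  intro u' hu'
  obtain ⟨C, hC⟩ := h u' (hu'.trans_le huv)
  refine ⟨C, fun t => ?_⟩
  obtain ⟨Q, h1, h2, h3⟩ := hC t
  exact ⟨Q, fun x hx => hB (h1 x hx), h2, h3⟩

theorem of_forall_lt (h : ∀ v < u, PackRate p A k v) : PackRate p A k u := by
  intro u' hu'
  obtain ⟨v, hv, hv'⟩ := exists_between hu'
  exact h v hv' u' hv

theorem zero : PackRate p A k 0 := by
  intro u' hu'
  refine ⟨0, fun t => ⟨∅, by simp, ?_, by simp⟩⟩
  have : u' * t ≤ 0 := mul_nonpos_of_nonpos_of_nonneg hu'.le (Nat.cast_nonneg t)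
  simpa using this

theorem affine [hp : Fact p.Prime] (h : PackRate p A k u) (c : ℤ) (m : ℕ) :
    PackRate p ((fun x => c + (p : ℤ) ^ m * x) '' A) (k + m) u := by
  classical
  intro u' hu'
  obtain ⟨C, hC⟩ := h u' hu'
  refine ⟨C, fun t => ?_⟩
  obtain ⟨Q, h1, h2, h3⟩ := hC t
  have hp0 : (p : ℤ) ^ m ≠ 0 := pow_ne_zero _ (by exact_mod_cast hp.out.ne_zero)
  have hinj : Function.Injective fun x : ℤ => c + (p : ℤ) ^ m * x := by
    intro x y hxy
    exact mul_left_cancel₀ hp0 (add_left_cancel hxy)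
  refine ⟨Q.image fun x => c + (p : ℤ) ^ m * x, ?_, ?_, ?_⟩
  · intro y hy
    obtain ⟨x, hx, rfl⟩ := Finset.mem_image.1 hy
    exact ⟨x, h1 x hx, rfl⟩
  · rwa [Finset.card_image_of_injective _ hinj]
  · intro y hy
    obtain ⟨x, hx, rfl⟩ := Finset.mem_image.1 hy
    rw [← Finset.image_erase hinj, Finset.card_image_of_injective _ hinj,
      Finset.sum_image hinj.injOn]
    have e : ∀ y ∈ Q.erase x, padicValInt p (c + (p : ℤ) ^ m * x - (c + (p : ℤ) ^ m * y)) =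
        m + padicValInt p (x - y) := by
      intro y hy
      have hne : x - y ≠ 0 := sub_ne_zero.2 (Finset.ne_of_mem_erase hy).symm
      rw [show c + (p : ℤ) ^ m * x - (c + (p : ℤ) ^ m * y) = (p : ℤ) ^ m * (x - y) by ring,
        padicValInt.mul hp0 hne]
      congr 1
      rw [← Nat.cast_pow, padicValInt.of_nat, padicValNat.prime_pow]
    rw [Finset.sum_congr rfl e, Finset.sum_add_distrib, Finset.sum_const, smul_eq_mul]
    have := h3 x hx
    nlinarith

/-- Points from different parts have a difference of valuation at most `k`, so they add nothing
beyond the discount. -/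
theorem union (hA : PackRate p A k u) (hB : PackRate p B k v)
    (hd : ∀ x ∈ A, ∀ y ∈ B, ¬ (p : ℤ) ^ (k + 1) ∣ x - y) :
    PackRate p (A ∪ B) k (u + v) := by
  classical
  intro w hw
  obtain ⟨C, hC⟩ := hA (u - (u + v - w) / 2) (by linarith)
  obtain ⟨D, hD⟩ := hB (v - (u + v - w) / 2) (by linarith)
  refine ⟨C + D, fun t => ?_⟩
  obtain ⟨P, h1, h2, h3⟩ := hC t
  obtain ⟨Q, g1, g2, g3⟩ := hD t
  have val : ∀ z : ℤ, ¬ (p : ℤ) ^ (k + 1) ∣ z → padicValInt p z ≤ k := by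
    intro z hz
    by_contra hc
    exact hz ((pow_dvd_pow _ (by omega)).trans (padicValInt_dvd z))
  have hdisj : Disjoint P Q := by
    rw [Finset.disjoint_left]
    intro x hP hQ
    exact hd x (h1 x hP) x (g1 x hQ) (by simp)
  have side : ∀ (R : Finset ℤ) (x : ℤ), (∀ y ∈ R, ¬ (p : ℤ) ^ (k + 1) ∣ x - y) →
      ∑ y ∈ R, padicValInt p (x - y) ≤ k * R.card := by
    intro R x hR
    have := Finset.sum_le_card_nsmul R (fun y => padicValInt p (x - y)) k
      fun y hy => val _ (hR y hy)
    rwa [smul_eq_mul, mul_comm] at this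
  refine ⟨P ∪ Q, ?_, ?_, ?_⟩
  · intro x hx
    exact (Finset.mem_union.1 hx).imp (h1 x) (g1 x)
  · rw [Finset.card_union_of_disjoint hdisj]
    push_cast
    linarith
  · intro x hx
    rcases Finset.mem_union.1 hx with hx | hx
    · have hxQ : x ∉ Q := Finset.disjoint_left.1 hdisj hx
      rw [Finset.erase_union_distrib, Finset.erase_eq_of_notMem hxQ]
      have hd' : Disjoint (P.erase x) Q :=
        Finset.disjoint_of_subset_left (Finset.erase_subset _ _) hdisj
      rw [Finset.sum_union hd', Finset.card_union_of_disjoint hd']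
      have := h3 x hx
      have := side Q x fun y hy => hd x (h1 x hx) y (g1 y hy)
      nlinarith
    · have hxP : x ∉ P := Finset.disjoint_right.1 hdisj hx
      rw [Finset.erase_union_distrib, Finset.erase_eq_of_notMem hxP]
      have hd' : Disjoint P (Q.erase x) :=
        Finset.disjoint_of_subset_right (Finset.erase_subset _ _) hdisj
      rw [Finset.sum_union hd', Finset.card_union_of_disjoint hd']
      have := g3 x hx
      have := side P x fun y hy => by
        rw [dvd_sub_comm]
        exact hd y (h1 y hy) x (g1 x hx)
      nlinarith

theorem biUnion {ι : Type*} (s : Finset ι) (F : ι → Set ℤ) (w : ι → ℝ)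
    (h : ∀ i ∈ s, PackRate p (F i) k (w i))
    (hd : ∀ i ∈ s, ∀ j ∈ s, i ≠ j → ∀ x ∈ F i, ∀ y ∈ F j, ¬ (p : ℤ) ^ (k + 1) ∣ x - y) :
    PackRate p (⋃ i ∈ s, F i) k (∑ i ∈ s, w i) := by
  classical
  induction s using Finset.induction_on with
  | empty => simpa using PackRate.zero
  | insert a s ha ih =>
    rw [Finset.set_biUnion_insert, Finset.sum_insert ha]
    refine (h a (by simp)).union (ih (fun i hi => h i (by simp [hi]))
      fun i hi j hj => hd i (by simp [hi]) j (by simp [hj])) ?_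
    intro x hx y hy
    simp only [Set.mem_iUnion] at hy
    obtain ⟨i, hi, hy⟩ := hy
    exact hd a (by simp) i (by simp [hi]) (fun e => ha (e ▸ hi)) x hx y hy

/-- The same exchange as for covers, except that too many points are now harmful: `Q` is cut down
instead of padded. -/
theorem lift [hp : Fact p.Prime] (h : PackRate p A (k + 1) u) (hu : 0 ≤ u)
    (hA : ∀ x ∈ A, ∀ y ∈ A, (p : ℤ) ^ (k + 1) ∣ x - y) : PackRate p A k (u / (1 + u)) := by
  classical
  intro u' hu'
  by_cases hneg : u' < 0
  · exact PackRate.zero u' hneg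
  obtain ⟨w, hw0, hw, hwu⟩ := exists_lt_div_one_add_eq (not_lt.1 hneg) hu hu'
  obtain ⟨C, hC⟩ := h w hw
  have hw1 : 0 < 1 + w := by linarith
  refine ⟨w + |C|, fun t => ?_⟩
  set t' : ℕ := ⌊(t : ℝ) / (1 + w)⌋₊ with ht'
  have ht1 : (t' : ℝ) ≤ (t : ℝ) / (1 + w) := Nat.floor_le (by positivity)
  have ht2 : (t : ℝ) / (1 + w) < t' + 1 := Nat.lt_floor_add_one _
  obtain ⟨Q, h1, h2, h3⟩ := hC t'
  -- With at most `⌊w t'⌋ + 1` points in `R`, each has at most `w t'` others, and `t' + w t' ≤ t`.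
  obtain ⟨R, hRQ, hR⟩ := Finset.exists_subset_card_eq
    (s := Q) (n := min Q.card (⌊w * t'⌋₊ + 1)) (min_le_left _ _)
  refine ⟨R, fun x hx => h1 x (hRQ hx), ?_, ?_⟩
  · have e1 : w * t' - |C| ≤ R.card := by
      rw [hR]
      push_cast
      apply le_min
      · have := le_abs_self C
        linarith
      · have := Nat.lt_floor_add_one (w * t')
        have := abs_nonneg C
        linarith
    have e2 : w * (t / (1 + w)) ≤ w * (t' + 1) := mul_le_mul_of_nonneg_left ht2.le hw0
    have e3 : w * (t / (1 + w)) = u' * t := by rw [← hwu]; ring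
    linarith
  · intro x hx
    have hsub : R.erase x ⊆ Q.erase x := Finset.erase_subset_erase x hRQ
    have e1 := h3 x (hRQ hx)
    -- Each discarded point is congruent to `x` modulo `p ^ (k + 1)`, so discarding it lowers the
    -- sum by at least its discount `k + 1`.
    have lower : (k + 1) * (Q.erase x \ R.erase x).card ≤
        ∑ y ∈ Q.erase x \ R.erase x, padicValInt p (x - y) := by
      have := Finset.card_nsmul_le_sum (Q.erase x \ R.erase x)
        (fun y => padicValInt p (x - y)) (k + 1) fun y hy => by
          have hy' := (Finset.mem_sdiff.1 hy).1
          have hne : x - y ≠ 0 := sub_ne_zero.2 (Finset.ne_of_mem_erase hy').symm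
          exact ((padicValInt_dvd_iff (k + 1) (x - y)).1
            (hA x (h1 x (hRQ hx)) y (h1 y (Finset.mem_of_mem_erase hy')))).resolve_left hne
      rwa [smul_eq_mul, mul_comm] at this
    have e2 := Finset.sum_sdiff (f := fun y => padicValInt p (x - y)) hsub
    have e3 := Finset.card_sdiff_add_card_eq_card hsub
    have e4 : (R.erase x).card ≤ ⌊w * t'⌋₊ := by
      rw [Finset.card_erase_of_mem hx, hR]
      omega
    have e5 : t' + (R.erase x).card ≤ t := by
      have f1 : ((R.erase x).card : ℝ) ≤ w * t' :=
        (Nat.cast_le.2 e4).trans (Nat.floor_le (by positivity))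
      have f2 : (t' : ℝ) + (R.erase x).card ≤ t := by
        rw [le_div_iff₀ hw1] at ht1
        linarith
      exact_mod_cast f2
    rw [← e3] at e1
    nlinarith

end PackRate

/-! ### From rates to the valuative capacity. -/

theorem padicValInt_prod {p : ℕ} [Fact p.Prime] {ι : Type*} (s : Finset ι) (f : ι → ℤ)
    (hf : ∀ i ∈ s, f i ≠ 0) : padicValInt p (∏ i ∈ s, f i) = ∑ i ∈ s, padicValInt p (f i) := by
  classical
  induction s using Finset.induction_on with
  | empty => simp
  | insert a s ha ih =>
    rw [Finset.prod_insert ha, Finset.sum_insert ha, padicValInt.mul (hf a (by simp))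
      (Finset.prod_ne_zero_iff.2 fun i hi => hf i (by simp [hi])),
      ih fun i hi => hf i (by simp [hi])]

/-- The degrees of divisibility attained by the leading coefficients in `I_n`. -/
def leadingExponents (p : ℕ) (E : Set ℤ) (n : ℕ) : Set ℤ :=
  {k : ℤ | ∃ a ∈ characteristicIdeal E n, a ≠ 0 ∧ k = -padicValRat p a}

theorem natCast_mem_leadingExponents {p : ℕ} [hp : Fact p.Prime] {E : Set ℤ} {n t : ℕ}
    (P : Multiset ℤ) (hn : P.card ≤ n)
    (hP : ∀ x ∈ E, (p : ℤ) ^ t ∣ (P.map fun y => x - y).prod) :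
    (t : ℤ) ∈ leadingExponents p E n := by
  have hp0 : (p : ℚ) ^ t ≠ 0 := pow_ne_zero _ (by exact_mod_cast hp.out.ne_zero)
  set g : Polynomial ℚ := (P.map fun y : ℤ => Polynomial.X - Polynomial.C (y : ℚ)).prod with hg
  have hgm : g.Monic := Polynomial.monic_multiset_prod_of_monic P _
    fun y _ => Polynomial.monic_X_sub_C _
  have hgd : g.natDegree = P.card := by
    have := Polynomial.natDegree_multiset_prod_X_sub_C_eq_card (P.map fun y : ℤ => (y : ℚ))
    simpa [hg, Multiset.map_map, Function.comp_def] using this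
  refine ⟨((p : ℚ) ^ t)⁻¹, Or.inr ⟨Polynomial.C ((p : ℚ) ^ t)⁻¹ * g, ?_, ?_, ?_⟩,
    inv_ne_zero hp0, ?_⟩
  · intro x hx
    obtain ⟨z, hz⟩ := hP x hx
    refine ⟨z, ?_⟩
    have e : g.eval (x : ℚ) = (((P.map fun y => x - y).prod : ℤ) : ℚ) := by
      rw [hg, Polynomial.eval_multiset_prod, Int.cast_multiset_prod]
      simp [Multiset.map_map]
    rw [Polynomial.eval_mul, Polynomial.eval_C, e, hz]
    push_cast
    field_simp
  · rw [Polynomial.natDegree_C_mul (inv_ne_zero hp0), hgd]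
    exact hn
  · rw [Polynomial.leadingCoeff_mul, hgm.leadingCoeff, Polynomial.leadingCoeff_C, mul_one]
  · rw [padicValRat.inv, neg_neg, padicValRat.pow,
      show padicValRat p (p : ℚ) = 1 from padicValRat.self hp.out.one_lt]
    simp

/-- By Lagrange interpolation on `Q`, the leading coefficient is a sum of terms `f x / ∏ (x - y)`
with integral numerators; the ultrametric inequality bounds its norm by `p ^ t`. -/
theorem le_of_mem_leadingExponents {p : ℕ} [hp : Fact p.Prime] {E : Set ℤ} {n t : ℕ}
    (Q : Finset ℤ) (hQE : ∀ x ∈ Q, x ∈ E) (hn : n + 1 ≤ Q.card)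
    (hQ : ∀ x ∈ Q, ∑ y ∈ Q.erase x, padicValInt p (x - y) ≤ t) :
    ∀ k ∈ leadingExponents p E n, k ≤ t := by
  rintro _ ⟨a, ha, ha0, rfl⟩
  obtain ⟨f, hf, hfn, rfl⟩ := ha.resolve_left ha0
  have hp1 : (1 : ℚ) < p := by exact_mod_cast hp.out.one_lt
  -- Interpolation needs degree exactly `Q.card - 1`; a power of `X` keeps the leading coefficient
  -- and the integrality on `E`.
  set g := f * Polynomial.X ^ (Q.card - 1 - f.natDegree) with hg
  have hf0 : f ≠ 0 := Polynomial.leadingCoeff_ne_zero.1 ha0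
  have hgl : g.leadingCoeff = f.leadingCoeff := by simp [hg]
  have hg0 : g ≠ 0 := Polynomial.leadingCoeff_ne_zero.1 (hgl ▸ ha0)
  have hgd : g.natDegree = Q.card - 1 := by
    rw [hg, Polynomial.natDegree_mul_X_pow (hp := hf0)]
    omega
  have hdeg : (Q.card : WithBot ℕ) = g.degree + 1 := by
    rw [Polynomial.degree_eq_natDegree hg0, hgd]
    norm_cast
    omega
  have hgE : ∀ x ∈ E, ∃ z : ℤ, g.eval (x : ℚ) = z := by
    intro x hx
    obtain ⟨z, hz⟩ := hf x hx
    exact ⟨z * x ^ (Q.card - 1 - f.natDegree), by simp [hg, hz]⟩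
  have key := Lagrange.leadingCoeff_eq_sum (s := Q) (v := fun x : ℤ => (x : ℚ))
    (Int.cast_injective.injOn) hdeg
  have hnorm : padicNorm p f.leadingCoeff ≤ (p : ℚ) ^ (t : ℤ) := by
    rw [← hgl, key]
    refine padicNorm.sum_le' (fun x hx => ?_) (by positivity)
    obtain ⟨z, hz⟩ := hgE x (hQE x hx)
    have hne : ∀ y ∈ Q.erase x, x - y ≠ 0 := fun y hy =>
      sub_ne_zero.2 (Finset.ne_of_mem_erase hy).symm
    have hD : ∏ y ∈ Q.erase x, (x - y) ≠ 0 := Finset.prod_ne_zero_iff.2 hne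
    have e : ∏ y ∈ Q.erase x, ((x : ℚ) - y) = ((∏ y ∈ Q.erase x, (x - y) : ℤ) : ℚ) := by
      push_cast; rfl
    rw [hz, e, padicNorm.div,
      padicNorm.eq_zpow_of_nonzero (q := ((∏ y ∈ Q.erase x, (x - y) : ℤ) : ℚ))
        (Int.cast_ne_zero.2 hD), padicValRat.of_int, padicValInt_prod _ _ hne, zpow_neg,
      div_inv_eq_mul]
    calc _ ≤ 1 * (p : ℚ) ^ ((∑ y ∈ Q.erase x, padicValInt p (x - y) : ℕ) : ℤ) :=
          mul_le_mul_of_nonneg_right (padicNorm.of_int z) (by positivity)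
      _ ≤ _ := by
          rw [one_mul]
          exact zpow_le_zpow_right₀ hp1.le (by exact_mod_cast hQ x hx)
  rw [padicNorm.eq_zpow_of_nonzero ha0, zpow_le_zpow_iff_right₀ hp1] at hnorm
  exact hnorm

theorem isValuativeCapacity_of_rates {p : ℕ} [hp : Fact p.Prime] {E : Set ℤ} {u : ℝ}
    (hu : 0 < u) (hc : CoverRate p E 0 0 u) (hq : PackRate p E 0 u) :
    IsValuativeCapacity p E (1 / u) := by
  have upper : ∀ u', u' < u → ∃ C : ℝ, ∀ n t : ℕ, (n : ℝ) + 1 ≤ u' * t - C →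
      ∀ k ∈ leadingExponents p E n, k ≤ t := by
    intro u' hu'
    obtain ⟨C, hC⟩ := hq u' hu'
    refine ⟨C, fun n t hn => ?_⟩
    obtain ⟨Q, h1, h2, h3⟩ := hC t
    exact le_of_mem_leadingExponents Q h1 (by exact_mod_cast hn.trans h2)
      fun x hx => by simpa using h3 x hx
  have lower : ∀ u', u < u' → ∃ C : ℝ, ∀ n t : ℕ, u' * t + C ≤ n →
      (t : ℤ) ∈ leadingExponents p E n := by
    intro u' hu'
    obtain ⟨C, hC⟩ := hc u' hu'
    refine ⟨C, fun n t hn => ?_⟩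
    obtain ⟨P, -, h2, h3⟩ := hC t
    exact natCast_mem_leadingExponents P (by exact_mod_cast h2.trans hn)
      fun x hx => by simpa using h3 x hx
  have ex : ∀ n, ∃ a : ℤ, IsGreatest (leadingExponents p E n) a := by
    intro n
    obtain ⟨C, hC⟩ := upper (u / 2) (by linarith)
    obtain ⟨t, ht⟩ := exists_nat_ge (((n : ℝ) + 1 + C) / (u / 2))
    rw [div_le_iff₀ (by linarith)] at ht
    have hb := hC n t (by linarith)
    have hne : (0 : ℤ) ∈ leadingExponents p E n := by
      simpa using natCast_mem_leadingExponents (p := p) (E := E) (n := n) (t := 0) 0 (by simp)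
        (by simp)
    obtain ⟨a, ha, ha'⟩ := Int.exists_greatest_of_bdd (P := fun z => z ∈ leadingExponents p E n)
      ⟨t, hb⟩ ⟨0, hne⟩
    exact ⟨a, ha, ha'⟩
  choose α hα using ex
  refine ⟨α, hα, tendsto_order.2 ⟨fun a ha => ?_, fun a ha => ?_⟩⟩
  · obtain ⟨b, hab, hb⟩ := exists_between (max_lt ha (one_div_pos.2 hu))
    have hb0 : 0 < b := (le_max_right _ _).trans_lt hab
    have hab' : a < b := (le_max_left _ _).trans_lt hab
    obtain ⟨C, hC⟩ := lower (1 / b) (by rwa [lt_one_div hu hb0])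
    have hlim : Filter.Tendsto (fun n : ℕ => (b - a) * (n : ℝ)) Filter.atTop Filter.atTop :=
      tendsto_natCast_atTop_atTop.const_mul_atTop (by linarith)
    filter_upwards [hlim.eventually_gt_atTop (b * |C| + 1), Filter.eventually_gt_atTop 0,
      tendsto_natCast_atTop_atTop.eventually_ge_atTop C] with n hn hn0 hnC
    have hn0' : (0 : ℝ) < n := by exact_mod_cast hn0
    rw [lt_div_iff₀ hn0']
    -- The exponent `t = ⌊b (n - C)⌋` is the largest with `t / b + C ≤ n`.
    have f1 : (⌊b * (n - C)⌋₊ : ℝ) ≤ b * (n - C) :=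
      Nat.floor_le (mul_nonneg hb0.le (by linarith))
    have f2 := Nat.lt_floor_add_one (b * (n - C))
    have f3 : 1 / b * (⌊b * (n - C)⌋₊ : ℝ) + C ≤ n := by
      have := mul_le_mul_of_nonneg_left f1 (one_div_pos.2 hb0).le
      have e : 1 / b * (b * (n - C)) = n - C := by field_simp
      linarith
    have f4 : ((⌊b * (n - C)⌋₊ : ℤ) : ℝ) ≤ α n := Int.cast_le.2 ((hα n).2 (hC n _ f3))
    have f5 : b * C ≤ b * |C| := mul_le_mul_of_nonneg_left (le_abs_self C) hb0.le
    push_cast at f4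
    nlinarith
  · obtain ⟨b, hb, hba⟩ := exists_between ha
    have hb0 : 0 < b := (one_div_pos.2 hu).trans hb
    obtain ⟨C, hC⟩ := upper (1 / b) (by rwa [one_div_lt hb0 hu])
    have hlim : Filter.Tendsto (fun n : ℕ => (a - b) * (n : ℝ)) Filter.atTop Filter.atTop :=
      tendsto_natCast_atTop_atTop.const_mul_atTop (by linarith)
    filter_upwards [hlim.eventually_gt_atTop (b * (|C| + 1) + 1),
      Filter.eventually_gt_atTop 0] with n hn hn0
    have hn0' : (0 : ℝ) < n := by exact_mod_cast hn0
    rw [div_lt_iff₀ hn0']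
    have f0 : 0 ≤ b * (n + 1 + |C|) := by positivity
    have f1 := Nat.le_ceil (b * (n + 1 + |C|))
    have f2 := Nat.ceil_lt_add_one f0
    have f3 : (n : ℝ) + 1 ≤ 1 / b * (⌈b * (n + 1 + |C|)⌉₊ : ℝ) - C := by
      have := mul_le_mul_of_nonneg_left f1 (one_div_pos.2 hb0).le
      have e : 1 / b * (b * (n + 1 + |C|)) = n + 1 + |C| := by field_simp
      have := le_abs_self C
      linarith
    have f4 : (α n : ℝ) ≤ ((⌈b * (n + 1 + |C|)⌉₊ : ℤ) : ℝ) :=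
      Int.cast_le.2 (hC n _ f3 _ (hα n).1)
    push_cast at f4
    nlinarith

/-! ### Residue classes, their children, and the rate of a full class. -/

/-- The residue class of `r` modulo `p ^ k`. -/
def residueClass (p : ℕ) (r : ℤ) (k : ℕ) : Set ℤ :=
  {x | (p : ℤ) ^ k ∣ x - r}

theorem residueClass_eq_iUnion {p : ℕ} (hp : 0 < p) (r : ℤ) (k : ℕ) :
    residueClass p r k =
      ⋃ j ∈ Finset.range p, residueClass p (r + (j : ℤ) * (p : ℤ) ^ k) (k + 1) := by
  ext x
  simp only [residueClass, Set.mem_ofPred_eq, Set.mem_iUnion, Finset.mem_range, exists_prop]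
  constructor
  · rintro ⟨z, hz⟩
    have hp' : (0 : ℤ) < p := by exact_mod_cast hp
    have h0 := Int.emod_nonneg z hp'.ne'
    have h1 := Int.emod_lt_of_pos z hp'
    refine ⟨(z % p).toNat, by omega, z / p, ?_⟩
    rw [Int.toNat_of_nonneg h0, ← sub_sub, hz]
    have := Int.emod_add_mul_ediv z p
    linear_combination -(p : ℤ) ^ k * this
  · rintro ⟨j, -, z, hz⟩
    exact ⟨j + p * z, by linear_combination hz⟩

theorem not_dvd_sub_of_mem_residueClass {p : ℕ} (hp : 0 < p) {r : ℤ} {k i j : ℕ} (hi : i < p)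
    (hj : j < p) (hij : i ≠ j) {x y : ℤ}
    (hx : x ∈ residueClass p (r + (i : ℤ) * (p : ℤ) ^ k) (k + 1))
    (hy : y ∈ residueClass p (r + (j : ℤ) * (p : ℤ) ^ k) (k + 1)) :
    ¬ (p : ℤ) ^ (k + 1) ∣ x - y := by
  intro h
  have h1 : (p : ℤ) ^ (k + 1) ∣ ((i : ℤ) - j) * (p : ℤ) ^ k := by
    have := dvd_add (dvd_sub h hx) hy
    rwa [show x - y - (x - (r + (i : ℤ) * (p : ℤ) ^ k)) + (y - (r + (j : ℤ) * (p : ℤ) ^ k)) =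
      ((i : ℤ) - j) * (p : ℤ) ^ k by ring] at this
  have hpk : (p : ℤ) ^ k ≠ 0 := pow_ne_zero _ (by exact_mod_cast hp.ne')
  rw [pow_succ', mul_dvd_mul_iff_right hpk] at h1
  have := Int.eq_zero_of_abs_lt_dvd h1 (by rw [abs_lt]; omega)
  omega

theorem CoverRate.of_children {p : ℕ} {A : Set ℤ} {r : ℤ} {k : ℕ} (s : Finset ℕ)
    (w : ℕ → ℝ) (hw : ∀ j ∈ s, 0 ≤ w j)
    (h : ∀ j ∈ s, CoverRate p (A ∩ residueClass p (r + (j : ℤ) * (p : ℤ) ^ k) (k + 1))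
      (r + (j : ℤ) * (p : ℤ) ^ k) (k + 1) (w j)) :
    CoverRate p (⋃ j ∈ s, A ∩ residueClass p (r + (j : ℤ) * (p : ℤ) ^ k) (k + 1)) r k
      (∑ j ∈ s, w j / (1 + w j)) := by
  refine CoverRate.biUnion s _ _ (fun j hj => (h j hj).lift (hw j hj) (fun x hx => hx.2)
    ⟨j, by ring⟩) ?_
  rintro j hj x ⟨-, z, hz⟩
  exact ⟨j + p * z, by linear_combination hz⟩

theorem PackRate.of_children {p : ℕ} [hp : Fact p.Prime] {A : Set ℤ} {r : ℤ} {k : ℕ}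
    (s : Finset ℕ) (hs : ∀ j ∈ s, j < p) (w : ℕ → ℝ) (hw : ∀ j ∈ s, 0 ≤ w j)
    (h : ∀ j ∈ s, PackRate p (A ∩ residueClass p (r + (j : ℤ) * (p : ℤ) ^ k) (k + 1))
      (k + 1) (w j)) :
    PackRate p (⋃ j ∈ s, A ∩ residueClass p (r + (j : ℤ) * (p : ℤ) ^ k) (k + 1)) k
      (∑ j ∈ s, w j / (1 + w j)) := by
  refine PackRate.biUnion s _ _ (fun j hj => (h j hj).lift (hw j hj) ?_) ?_
  · rintro x ⟨-, hx⟩ y ⟨-, hy⟩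
    have := dvd_sub hx hy
    rwa [sub_sub_sub_cancel_right] at this
  · rintro i hi j hj hij x ⟨-, hx⟩ y ⟨-, hy⟩
    exact not_dvd_sub_of_mem_residueClass hp.out.pos (hs i hi) (hs j hj) hij hx hy

theorem affine_image_univ (p : ℕ) (r : ℤ) (k : ℕ) :
    (fun x : ℤ => r + (p : ℤ) ^ k * x) '' Set.univ = residueClass p r k := by
  ext x
  simp only [Set.image_univ, Set.mem_range, residueClass, Set.mem_ofPred_eq]
  exact ⟨fun ⟨z, hz⟩ => ⟨z, by linear_combination -hz⟩, fun ⟨z, hz⟩ => ⟨z, by linear_combination -hz⟩⟩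

theorem CoverRate.univ_le {p : ℕ} (hp : 0 < p) : CoverRate p Set.univ 0 0 p := by
  intro u' hu'
  refine ⟨0, fun t => ⟨t • (Multiset.range p).map (fun j : ℕ => (j : ℤ)), by simp, ?_, ?_⟩⟩
  · have : (p : ℝ) * t ≤ u' * t := mul_le_mul_of_nonneg_right hu'.le (Nat.cast_nonneg t)
    simp only [Multiset.card_nsmul, Multiset.card_map, Multiset.card_range]
    push_cast
    linarith
  · intro x _
    rw [Multiset.map_nsmul, Multiset.prod_nsmul, zero_mul, add_zero]
    apply pow_dvd_pow_of_dvd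
    have hp' : (0 : ℤ) < p := by exact_mod_cast hp
    have h0 := Int.emod_nonneg x hp'.ne'
    have h1 := Int.emod_lt_of_pos x hp'
    refine (Int.dvd_self_sub_emod (x := x) (m := p)).trans (Multiset.dvd_prod ?_)
    refine Multiset.mem_map.2 ⟨x % p, Multiset.mem_map.2 ⟨(x % p).toNat, ?_, ?_⟩, rfl⟩
    · rw [Multiset.mem_range]; omega
    · exact Int.toNat_of_nonneg h0

theorem CoverRate.residueClass_of_univ {p : ℕ} {u : ℝ} (h : CoverRate p Set.univ 0 0 u) (r : ℤ)
    (k : ℕ) : CoverRate p (residueClass p r k) r k u := by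
  have := h.affine r k
  rwa [affine_image_univ, mul_zero, add_zero, zero_add] at this

theorem CoverRate.isLeast_csInf {p : ℕ} {A : Set ℤ} {r : ℤ} {k : ℕ} {v : ℝ} (hv : 0 ≤ v)
    (h : CoverRate p A r k v) :
    IsLeast {u | 0 ≤ u ∧ CoverRate p A r k u} (sInf {u | 0 ≤ u ∧ CoverRate p A r k u}) := by
  have hb : BddBelow {u | 0 ≤ u ∧ CoverRate p A r k u} := ⟨0, fun u hu => hu.1⟩
  have hne : {u | 0 ≤ u ∧ CoverRate p A r k u}.Nonempty := ⟨v, hv, h⟩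
  refine ⟨⟨le_csInf hne fun u hu => hu.1, CoverRate.of_forall_gt fun w hw => ?_⟩,
    fun u hu => csInf_le hb hu⟩
  obtain ⟨u, hu, huw⟩ := exists_lt_of_csInf_lt hne hw
  exact hu.2.anti subset_rfl huw.le

/-- The cap `b` makes the supremum exist without an a priori bound on packing rates. -/
theorem PackRate.exists_isGreatest {p : ℕ} {A : Set ℤ} {k : ℕ} {b : ℝ} (hb : 0 ≤ b) :
    ∃ v, IsGreatest {u | 0 ≤ u ∧ u ≤ b ∧ PackRate p A k u} v := by
  have hbd : BddAbove {u | 0 ≤ u ∧ u ≤ b ∧ PackRate p A k u} := ⟨b, fun u hu => hu.2.1⟩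
  have hz : 0 ∈ {u | 0 ≤ u ∧ u ≤ b ∧ PackRate p A k u} := ⟨le_rfl, hb, PackRate.zero⟩
  refine ⟨sSup _, ⟨le_csSup hbd hz, csSup_le ⟨0, hz⟩ fun u hu => hu.2.1,
    PackRate.of_forall_lt fun w hw => ?_⟩, fun u hu => le_csSup hbd hu⟩
  obtain ⟨u, hu, huw⟩ := exists_lt_of_lt_csSup ⟨0, hz⟩ hw
  exact hu.2.2.mono subset_rfl huw.le

/-- Self-similarity: `ℤ` is `p` copies of itself one level down, so the least rate satisfies `u ≤ p
u / (1 + u)`, which forces `u ≤ p - 1`. -/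
theorem CoverRate.univ {p : ℕ} (hp : 1 < p) : CoverRate p Set.univ 0 0 ((p : ℝ) - 1) := by
  have hp0 : 0 < p := by omega
  obtain ⟨⟨h0, h⟩, hle⟩ := (CoverRate.univ_le hp0).isLeast_csInf (Nat.cast_nonneg p)
  set u := sInf {u | 0 ≤ u ∧ CoverRate p Set.univ 0 0 u} with hu
  have h' := CoverRate.of_children (A := Set.univ) (r := 0) (k := 0) (Finset.range p)
    (fun _ => u) (fun _ _ => h0)
    (fun j _ => by rw [Set.univ_inter]; exact h.residueClass_of_univ _ _)
  simp only [Set.univ_inter, ← residueClass_eq_iUnion hp0] at h'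
  have e : residueClass p 0 0 = Set.univ := by ext; simp [residueClass]
  rw [e, Finset.sum_const, Finset.card_range, nsmul_eq_mul] at h'
  have h1 : u ≤ p * (u / (1 + u)) := hle ⟨by positivity, h'⟩
  have hp1 : (1 : ℝ) < p := by exact_mod_cast hp
  refine h.anti subset_rfl ?_
  by_contra hc
  rw [← mul_div_assoc, le_div_iff₀ (by linarith)] at h1
  nlinarith

theorem sum_padicValNat_succ {p : ℕ} [Fact p.Prime] (n : ℕ) :
    ∑ i ∈ Finset.range n, padicValNat p (i + 1) = padicValNat p n.factorial := by
  induction n with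
  | zero => simp
  | succ n ih =>
    rw [Finset.sum_range_succ, ih, Nat.factorial_succ,
      padicValNat.mul (Nat.succ_ne_zero n) (Nat.factorial_ne_zero n), add_comm]

theorem sum_padicValInt_sub {p : ℕ} [Fact p.Prime] (a b : ℕ) :
    ∑ j ∈ Finset.range (a + (b + 1)), padicValInt p ((a : ℤ) - j) =
      padicValNat p a.factorial + padicValNat p b.factorial := by
  rw [Finset.sum_range_add, ← sum_padicValNat_succ, ← sum_padicValNat_succ,
    ← Finset.sum_range_reflect, Finset.sum_range_succ' _ b]
  congr 1
  · refine Finset.sum_congr rfl fun i hi => ?_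
    rw [Finset.mem_range] at hi
    rw [padicValInt]
    congr 1
    omega
  · have : padicValInt p ((a : ℤ) - ((a + 0 : ℕ) : ℤ)) = 0 := by simp
    rw [this, add_zero]
    refine Finset.sum_congr rfl fun i _ => ?_
    rw [padicValInt]
    congr 1
    omega

/-- The points `0, …, (p - 1) t` work: the sum at `a` is the valuation of `a! b!` with `a + b = (p -
1) t`, and Legendre's formula gives `(p - 1) ν(a!) ≤ a`. -/
theorem PackRate.univ {p : ℕ} [hp : Fact p.Prime] :
    PackRate p Set.univ 0 ((p : ℝ) - 1) := by
  classical
  intro u' hu'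
  have hp1 := hp.out.one_lt
  refine ⟨0, fun t => ⟨(Finset.range ((p - 1) * t + 1)).image fun j : ℕ => (j : ℤ), by simp,
    ?_, ?_⟩⟩
  · rw [Finset.card_image_of_injective _ Nat.cast_injective, Finset.card_range]
    have : u' * t ≤ (p - 1) * t := mul_le_mul_of_nonneg_right hu'.le (Nat.cast_nonneg t)
    push_cast [Nat.cast_sub hp1.le]
    linarith
  · intro x hx
    obtain ⟨a, ha, rfl⟩ := Finset.mem_image.1 hx
    rw [Finset.mem_range] at ha
    rw [Finset.sum_erase _ (by simp), Finset.sum_image Nat.cast_injective.injOn, zero_mul,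
      add_zero]
    obtain ⟨b, hb⟩ := Nat.exists_eq_add_of_le (Nat.le_of_lt_succ ha)
    rw [hb, add_assoc, sum_padicValInt_sub]
    have e1 := sub_one_mul_padicValNat_factorial (p := p) a
    have e2 := sub_one_mul_padicValNat_factorial (p := p) b
    have e3 : (p - 1) * (padicValNat p a.factorial + padicValNat p b.factorial) ≤ (p - 1) * t := by
      rw [mul_add]
      omega
    exact Nat.le_of_mul_le_mul_left e3 (by omega)

theorem PackRate.residueClass {p : ℕ} [hp : Fact p.Prime] (r : ℤ) (k : ℕ) :
    PackRate p (residueClass p r k) k ((p : ℝ) - 1) := by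
  have := (PackRate.univ (p := p)).affine r k
  rwa [affine_image_univ, zero_add] at this

/-! ### Correctness of the recursion on lists of rates. -/

/-- The value of a fraction given as a pair of numerator and denominator. -/
noncomputable def fracValue (x : ℕ × ℕ) : ℝ := x.1 / x.2

theorem fracValue_nonneg (x : ℕ × ℕ) : 0 ≤ fracValue x := by
  unfold fracValue; positivity

theorem fracValue_pos_iff {x : ℕ × ℕ} (hx : 0 < x.2) : 0 < fracValue x ↔ 0 < x.1 := by
  have : (0 : ℝ) < x.2 := by exact_mod_cast hx
  rw [fracValue, div_pos_iff_of_pos_right this, Nat.cast_pos]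

theorem fracValue_addLifted {x y : ℕ × ℕ} (hx : 0 < x.2) (hy : 0 < y.2) :
    fracValue (addLifted x y) = fracValue x + fracValue y / (1 + fracValue y) := by
  have hx' : (0 : ℝ) < x.2 := by exact_mod_cast hx
  have hy' : (0 : ℝ) < y.2 := by exact_mod_cast hy
  have hs : (0 : ℝ) < (y.1 : ℝ) + y.2 := by positivity
  have e : 1 + (y.1 : ℝ) / y.2 = (y.1 + y.2) / y.2 := by field_simp; ring
  simp only [fracValue, addLifted]
  push_cast
  rw [e]
  field_simp

theorem liftedSum_map_range (f : ℕ → ℕ × ℕ) (n : ℕ) (hf : ∀ j < n, 0 < (f j).2) :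
    0 < (liftedSum ((List.range n).map f)).2 ∧
      fracValue (liftedSum ((List.range n).map f)) =
        ∑ j ∈ Finset.range n, fracValue (f j) / (1 + fracValue (f j)) := by
  induction n with
  | zero => simp [liftedSum, fracValue]
  | succ n ih =>
    obtain ⟨h1, h2⟩ := ih fun j hj => hf j (hj.trans n.lt_succ_self)
    have hn := hf n n.lt_succ_self
    have e : liftedSum ((List.range (n + 1)).map f) =
        addLifted (liftedSum ((List.range n).map f)) (f n) := by
      simp [liftedSum, List.range_succ]
    rw [e, Finset.sum_range_succ, ← h2, fracValue_addLifted h1 hn]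
    exact ⟨Nat.mul_pos h1 (by omega), rfl⟩

theorem getD_map_range {α : Type*} (f : ℕ → α) (d : α) {n r : ℕ} (hr : r < n) :
    ((List.range n).map f).getD r d = f r := by
  simp [List.getD, hr]

/-- The list `U` holds valid rates for the parts of `A` in the residue classes modulo `p ^ k`. -/
structure IsRateList (p k : ℕ) (S : List ℕ) (A : Set ℤ) (U : List (ℕ × ℕ)) : Prop where
  den_pos : ∀ r < p ^ k, 0 < (U.getD r (0, 1)).2
  num_pos : ∀ r < p ^ k, (∃ c ∈ S, (c : ℤ) ∈ residueClass p r k) → 0 < (U.getD r (0, 1)).1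
  cover : ∀ r < p ^ k,
    CoverRate p (A ∩ residueClass p r k) r k (fracValue (U.getD r (0, 1)))
  pack : ∀ r < p ^ k, PackRate p (A ∩ residueClass p r k) k (fracValue (U.getD r (0, 1)))

theorem natCast_mem_residueClass_iff {p k c r : ℕ} (hr : r < p ^ k) :
    (c : ℤ) ∈ residueClass p r k ↔ c % p ^ k = r := by
  have e : c % p ^ k = r ↔ r ≡ c [MOD p ^ k] := by
    rw [Nat.ModEq, Nat.mod_eq_of_lt hr, eq_comm]
  rw [e, Nat.modEq_iff_dvd]
  simp [residueClass]

theorem isRateList_topRates {p m : ℕ} [hp : Fact p.Prime] (S : List ℕ) :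
    IsRateList p m S (cosetUnion (p ^ m) S) (topRates (p, m, S)) := by
  have hp1 := hp.out.one_lt
  have hget : ∀ r < p ^ m, (topRates (p, m, S)).getD r (0, 1) =
      if ∃ c ∈ S, c % (p ^ m) = r then (p - 1, 1) else (0, 1) := fun r hr =>
    getD_map_range _ _ hr
  have hval : fracValue (p - 1, 1) = (p : ℝ) - 1 := by
    simp [fracValue, Nat.cast_sub hp1.le]
  have hval0 : fracValue (0, 1) = 0 := by simp [fracValue]
  refine ⟨fun r hr => ?_, fun r hr => ?_, fun r hr => ?_, fun r hr => ?_⟩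
  · rw [hget r hr]; split_ifs <;> simp
  · rintro ⟨c, hc, hcr⟩
    rw [hget r hr, if_pos ⟨c, hc, (natCast_mem_residueClass_iff hr).1 hcr⟩]
    exact Nat.sub_pos_of_lt hp1
  · rw [hget r hr]
    split_ifs with h
    · rw [hval]
      exact ((CoverRate.univ hp1).residueClass_of_univ r m).anti Set.inter_subset_right le_rfl
    · rw [hval0]
      have e : cosetUnion (p ^ m) S ∩ residueClass p r m = ∅ := by
        ext x
        simp only [Set.mem_inter_iff, Set.mem_empty_iff_false, iff_false, not_and]
        rintro ⟨c, hc, hx⟩ hxr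
        refine h ⟨c, hc, (natCast_mem_residueClass_iff hr).1 ?_⟩
        have h1 := hx.dvd
        push_cast at h1
        have := dvd_add h1 hxr
        rwa [sub_add_sub_cancel] at this
      rw [e]
      exact CoverRate.empty
  · rw [hget r hr]
    split_ifs with h
    · rw [hval]
      obtain ⟨c, hc, hcr⟩ := h
      refine (PackRate.residueClass (r : ℤ) m).mono (fun x hx => ⟨⟨c, hc, ?_⟩, hx⟩) le_rfl
      have h1 := (natCast_mem_residueClass_iff hr).2 hcr
      refine (Int.modEq_iff_dvd.2 ?_)
      have := dvd_sub h1 hx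
      rw [sub_sub_sub_cancel_right] at this
      exact_mod_cast this
    · rw [hval0]
      exact PackRate.zero

theorem add_mul_pow_lt {p k r j : ℕ} (hr : r < p ^ k) (hj : j < p) :
    r + j * p ^ k < p ^ (k + 1) := by
  have : (j + 1) * p ^ k ≤ p * p ^ k := Nat.mul_le_mul_right _ hj
  rw [pow_succ']
  nlinarith

theorem IsRateList.step {p k : ℕ} [hp : Fact p.Prime] {S : List ℕ} {A : Set ℤ}
    {U : List (ℕ × ℕ)} (h : IsRateList p (k + 1) S A U) :
    IsRateList p k S A (rateStep p k U) := by
  have hget : ∀ r < p ^ k, (rateStep p k U).getD r (0, 1) =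
      liftedSum ((List.range p).map fun j => U.getD (r + j * p ^ k) (0, 1)) := fun r hr =>
    getD_map_range _ _ hr
  have hsum := fun r (hr : r < p ^ k) => liftedSum_map_range
    (fun j => U.getD (r + j * p ^ k) (0, 1)) p fun j hj => h.den_pos _ (add_mul_pow_lt hr hj)
  have hset : ∀ r : ℕ, A ∩ residueClass p r k = ⋃ j ∈ Finset.range p,
      A ∩ residueClass p ((r : ℤ) + (j : ℤ) * (p : ℤ) ^ k) (k + 1) := fun r => by
    rw [residueClass_eq_iUnion hp.out.pos, Set.inter_iUnion₂]
  refine ⟨fun r hr => ?_, fun r hr => ?_, fun r hr => ?_, fun r hr => ?_⟩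
  · rw [hget r hr]
    exact (hsum r hr).1
  · rintro ⟨c, hc, hcr⟩
    rw [hget r hr, ← fracValue_pos_iff (hsum r hr).1, (hsum r hr).2]
    rw [residueClass_eq_iUnion hp.out.pos] at hcr
    simp only [Set.mem_iUnion, Finset.mem_range, exists_prop] at hcr
    obtain ⟨j, hj, hcj⟩ := hcr
    have hlt := add_mul_pow_lt hr hj
    have hpos := h.num_pos _ hlt ⟨c, hc, by push_cast; exact hcj⟩
    rw [← fracValue_pos_iff (h.den_pos _ hlt)] at hpos
    refine Finset.sum_pos' (fun i _ => ?_) ⟨j, Finset.mem_range.2 hj, by positivity⟩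
    have := fracValue_nonneg (U.getD (r + i * p ^ k) (0, 1))
    positivity
  · rw [hget r hr, (hsum r hr).2, hset]
    refine CoverRate.of_children _ _ (fun j _ => fracValue_nonneg _) fun j hj => ?_
    have := h.cover _ (add_mul_pow_lt hr (Finset.mem_range.1 hj))
    push_cast at this
    exact this
  · rw [hget r hr, (hsum r hr).2, hset]
    refine PackRate.of_children _ (fun j hj => Finset.mem_range.1 hj) _
      (fun j _ => fracValue_nonneg _) fun j hj => ?_
    have := h.pack _ (add_mul_pow_lt hr (Finset.mem_range.1 hj))
    push_cast at this
    exact this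

/-! ### The homography along the zero classes. -/

/-- The value at `u` of the homography `(c + d u) / (a + b u)` stored as `((c, d), (a, b))`. -/
noncomputable def homographyValue (M : (ℕ × ℕ) × (ℕ × ℕ)) (u : ℝ) : ℝ :=
  (M.1.1 + M.1.2 * u) / (M.2.1 + M.2.2 * u)

theorem homographyValue_nonneg (M : (ℕ × ℕ) × (ℕ × ℕ)) {u : ℝ} (hu : 0 ≤ u) :
    0 ≤ homographyValue M u := by
  unfold homographyValue; positivity

theorem homographyValue_spineStep {n : ℕ × ℕ} {M : (ℕ × ℕ) × (ℕ × ℕ)} (hn : 0 < n.2)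
    (ha : 0 < M.2.1) {u : ℝ} (hu : 0 ≤ u) :
    homographyValue (spineStep n M) u =
      fracValue n + homographyValue M u / (1 + homographyValue M u) := by
  obtain ⟨n1, n2⟩ := n
  obtain ⟨⟨c, d⟩, a, b⟩ := M
  have hn' : (0 : ℝ) < n2 := by exact_mod_cast hn
  have ha' : (0 : ℝ) < a := by exact_mod_cast ha
  have hD : 0 < (a : ℝ) + b * u := by positivity
  have hT : 0 < (a : ℝ) + b * u + (c + d * u) := by positivity
  have hT' : 0 < (a : ℝ) + c + (b + d) * u := by positivity
  simp only [homographyValue, fracValue, spineStep]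
  push_cast
  have e1 : (n2 : ℝ) * (a + c) + n2 * (b + d) * u = n2 * (a + c + (b + d) * u) := by ring
  have e2 : 1 + ((c : ℝ) + d * u) / (a + b * u) = (a + c + (b + d) * u) / (a + b * u) := by
    field_simp; ring
  rw [e1, e2, div_div_div_cancel_right₀ hD.ne', div_add_div _ _ hn'.ne' hT'.ne']
  congr 1
  ring

/-- The homography `M` computes the rate of the zero class modulo `p ^ k` from that of the whole set. -/
structure IsSpine (p m k : ℕ) (S : List ℕ) (M : (ℕ × ℕ) × (ℕ × ℕ)) : Prop where
  a_pos : 0 < M.2.1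
  d_pos : 0 < M.1.2
  b_pos : k < m → 0 < M.2.2
  c_pos : (∃ c ∈ S, (c : ℤ) ∈ residueClass p 0 k) → 0 < M.1.1
  cover : ∀ E : Set ℤ, E = cosetUnion (p ^ m) S ∪ (fun x : ℤ => (p : ℤ) ^ m * x) '' E →
    ∀ u, 0 ≤ u → CoverRate p E 0 0 u →
      CoverRate p (E ∩ residueClass p 0 k) 0 k (homographyValue M u)
  pack : ∀ E : Set ℤ, E = cosetUnion (p ^ m) S ∪ (fun x : ℤ => (p : ℤ) ^ m * x) '' E →
    ∀ u, 0 ≤ u → PackRate p E 0 u → PackRate p (E ∩ residueClass p 0 k) k (homographyValue M u)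

/-- No coset of `S` is the zero class, so that class meets `E` exactly in `p ^ m E`, and the
homography is the identity. -/
theorem isSpine_top {p m : ℕ} [hp : Fact p.Prime] {S : List ℕ} (hS : ∀ c ∈ S, ¬ p ^ m ∣ c) :
    IsSpine p m m S ((0, 1), (1, 0)) := by
  have hval : ∀ u, homographyValue ((0, 1), (1, 0)) u = u := fun u => by simp [homographyValue]
  refine ⟨Nat.one_pos, Nat.one_pos, fun h => absurd h (lt_irrefl m), ?_, ?_, ?_⟩
  · rintro ⟨c, hc, h⟩
    refine absurd ?_ (hS c hc)
    have h' : (p : ℤ) ^ m ∣ c := by simpa [residueClass] using h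
    exact_mod_cast h'
  · intro E hE u hu h
    rw [hval]
    have := h.affine 0 m
    simp only [zero_add, mul_zero] at this
    refine this.anti ?_ le_rfl
    rintro x ⟨hx, hx0⟩
    rw [hE] at hx
    rcases hx with ⟨c, hc, hxc⟩ | hx
    · refine absurd ?_ (hS c hc)
      have h1 := hxc.dvd
      push_cast at h1
      have h2 : (p : ℤ) ^ m ∣ x := by simpa [residueClass] using hx0
      have h3 := dvd_add h1 h2
      rw [sub_add_cancel] at h3
      exact_mod_cast h3
    · exact hx
  · intro E hE u hu h
    rw [hval]
    have := h.affine 0 m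
    simp only [zero_add] at this
    refine this.mono (fun x hx => ⟨by rw [hE]; exact Or.inr hx, ?_⟩) le_rfl
    obtain ⟨y, -, rfl⟩ := hx
    exact ⟨y, by simp⟩

/-- Only the zero child depends on `E`: since `k < m`, the other children avoid `p ^ m E` and their
rates are already in `U`. Positivity of `d` is carried along because it makes `b` positive after one
step. -/
theorem IsSpine.step {p m k : ℕ} [hp : Fact p.Prime] {S : List ℕ} {U : List (ℕ × ℕ)}
    {M : (ℕ × ℕ) × (ℕ × ℕ)} (hkm : k < m) (h : IsSpine p m (k + 1) S M)
    (hU : IsRateList p (k + 1) S (cosetUnion (p ^ m) S) U) :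
    IsSpine p m k S (spineStep (sideRate p k U) M) := by
  have hp0 := hp.out.pos
  have hpp : p - 1 + 1 = p := Nat.sub_add_cancel hp0
  have hlt : ∀ j < p, j * p ^ k < p ^ (k + 1) := fun j hj => by
    simpa using add_mul_pow_lt (r := 0) (k := k) (by positivity) hj
  obtain ⟨hn, hnv⟩ := liftedSum_map_range (fun j => U.getD ((j + 1) * p ^ k) (0, 1)) (p - 1)
    fun j hj => hU.den_pos _ (hlt _ (by omega))
  change 0 < (sideRate p k U).2 at hn
  change fracValue (sideRate p k U) = _ at hnv
  have ha := h.a_pos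
  have hd := h.d_pos
  set w : ℝ → ℕ → ℝ := fun t j => if j = 0 then t else fracValue (U.getD (j * p ^ k) (0, 1))
    with hw
  have hw0 : ∀ t, 0 ≤ t → ∀ j, 0 ≤ w t j := fun t ht j => by
    simp only [hw]
    split_ifs
    exacts [ht, fracValue_nonneg _]
  have hsum : ∀ u, 0 ≤ u → homographyValue (spineStep (sideRate p k U) M) u =
      ∑ j ∈ Finset.range p, w (homographyValue M u) j / (1 + w (homographyValue M u) j) := by
    intro u hu
    rw [homographyValue_spineStep hn ha hu, ← hpp, Finset.sum_range_succ', hpp, hnv]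
    simp [hw]
  have hset : ∀ E : Set ℤ, E ∩ residueClass p 0 k = ⋃ j ∈ Finset.range p,
      E ∩ residueClass p ((0 : ℤ) + (j : ℤ) * (p : ℤ) ^ k) (k + 1) := fun E => by
    rw [residueClass_eq_iUnion hp0, Set.inter_iUnion₂]
  have hcell : ∀ E : Set ℤ, E = cosetUnion (p ^ m) S ∪ (fun x : ℤ => (p : ℤ) ^ m * x) '' E →
      ∀ j < p, j ≠ 0 → E ∩ residueClass p ((0 : ℤ) + (j : ℤ) * (p : ℤ) ^ k) (k + 1) =
        cosetUnion (p ^ m) S ∩ residueClass p ((j * p ^ k : ℕ) : ℤ) (k + 1) := by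
    intro E hE j hj hj0
    push_cast
    rw [zero_add]
    refine Set.Subset.antisymm ?_ (Set.inter_subset_inter_left _ ?_)
    · rintro x ⟨hx, hxj⟩
      refine ⟨?_, hxj⟩
      rw [hE] at hx
      refine hx.resolve_right ?_
      rintro ⟨y, -, rfl⟩
      refine not_dvd_sub_of_mem_residueClass (r := 0) hp0 hj hp0 hj0 (by simpa using hxj)
        (y := 0) (by simp [residueClass]) ?_
      rw [sub_zero]
      exact (pow_dvd_pow _ hkm).mul_right y
    · rw [hE]
      exact Set.subset_union_left
  refine ⟨Nat.mul_pos hn (by omega), ?_, fun _ => Nat.mul_pos hn (by omega), ?_, ?_, ?_⟩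
  · exact Nat.add_pos_right _ (Nat.mul_pos hn hd)
  · rintro ⟨c, hc, hc0⟩
    rw [residueClass_eq_iUnion hp0] at hc0
    simp only [Set.mem_iUnion, Finset.mem_range, exists_prop] at hc0
    obtain ⟨j, hj, hcj⟩ := hc0
    rcases j with _ | j
    · exact Nat.add_pos_right _ (Nat.mul_pos hn (h.c_pos ⟨c, hc, by simpa using hcj⟩))
    · refine Nat.add_pos_left (Nat.mul_pos ?_ (by omega)) _
      rw [← fracValue_pos_iff hn, hnv]
      have hpos := hU.num_pos _ (hlt _ hj) ⟨c, hc, by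
        push_cast
        rw [zero_add] at hcj
        exact_mod_cast hcj⟩
      rw [← fracValue_pos_iff (hU.den_pos _ (hlt _ hj))] at hpos
      refine Finset.sum_pos' (fun i _ => ?_) ⟨j, Finset.mem_range.2 (by omega), by positivity⟩
      have := fracValue_nonneg (U.getD ((i + 1) * p ^ k) (0, 1))
      positivity
  · intro E hE u hu hEu
    rw [hsum u hu, hset]
    refine CoverRate.of_children _ _ (fun j _ => hw0 _ (homographyValue_nonneg M hu) j)
      fun j hj => ?_
    by_cases hj0 : j = 0
    · subst hj0
      simpa [hw] using h.cover E hE u hu hEu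
    · rw [hcell E hE j (Finset.mem_range.1 hj) hj0]
      simpa [hw, hj0] using hU.cover _ (hlt j (Finset.mem_range.1 hj))
  · intro E hE u hu hEu
    rw [hsum u hu, hset]
    refine PackRate.of_children _ (fun j hj => Finset.mem_range.1 hj) _
      (fun j _ => hw0 _ (homographyValue_nonneg M hu) j) fun j hj => ?_
    by_cases hj0 : j = 0
    · subst hj0
      simpa [hw] using h.pack E hE u hu hEu
    · rw [hcell E hE j (Finset.mem_range.1 hj) hj0]
      simpa [hw, hj0] using hU.pack _ (hlt j (Finset.mem_range.1 hj))

theorem treeState_spec {p m : ℕ} [hp : Fact p.Prime] {S : List ℕ} (hS : ∀ c ∈ S, ¬ p ^ m ∣ c)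
    (i : ℕ) (hi : i ≤ m) :
    IsRateList p (m - i) S (cosetUnion (p ^ m) S) (treeState (p, m, S) i).1 ∧
      IsSpine p m (m - i) S (treeState (p, m, S) i).2 := by
  induction i with
  | zero => exact ⟨isRateList_topRates S, isSpine_top hS⟩
  | succ i ih =>
    obtain ⟨h1, h2⟩ := ih (by omega)
    have e : m - i = m - 1 - i + 1 := by omega
    rw [e] at h1 h2
    rw [show m - (i + 1) = m - 1 - i by omega]
    exact ⟨h1.step, h2.step (by omega) h1⟩

theorem isSpine_rootHomography {p m : ℕ} [hp : Fact p.Prime] {S : List ℕ}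
    (hS : ∀ c ∈ S, ¬ p ^ m ∣ c) : IsSpine p m 0 S (rootHomography (p, m, S)) := by
  have := (treeState_spec hS m le_rfl).2
  rwa [Nat.sub_self] at this

/-! ### The fixed point and the quadratic equation. -/

theorem exists_isValuativeCapacity {p m : ℕ} [hp : Fact p.Prime] {S : List ℕ}
    {M : (ℕ × ℕ) × (ℕ × ℕ)} (h : IsSpine p m 0 S M) (hb : 0 < M.2.2) (hc : 0 < M.1.1)
    {E : Set ℤ} (hE : E = cosetUnion (p ^ m) S ∪ (fun x : ℤ => (p : ℤ) ^ m * x) '' E) :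
    ∃ L : ℝ, IsValuativeCapacity p E L ∧
      (M.1.1 : ℝ) * L ^ 2 + ((M.1.2 : ℝ) - M.2.1) * L - M.2.2 = 0 := by
  have e : E ∩ residueClass p 0 0 = E := by ext; simp [residueClass]
  have hcov := h.cover E hE
  have hpack := h.pack E hE
  rw [e] at hcov hpack
  have ha := h.a_pos
  obtain ⟨⟨c, d⟩, a, b⟩ := M
  simp only at ha hb hc ⊢
  replace ha : (0 : ℝ) < a := by exact_mod_cast ha
  replace hb : (0 : ℝ) < b := by exact_mod_cast hb
  replace hc : (0 : ℝ) < c := by exact_mod_cast hc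
  have hd : (0 : ℝ) ≤ d := Nat.cast_nonneg d
  have hp1 : (1 : ℝ) < p := by exact_mod_cast hp.out.one_lt
  obtain ⟨⟨u0, u0c⟩, u0le⟩ := CoverRate.isLeast_csInf (A := E) (p := p) (r := 0) (k := 0)
    (v := (p : ℝ) - 1) (by linarith)
    ((CoverRate.univ hp.out.one_lt).anti (Set.subset_univ E) le_rfl)
  set y := sInf {u | 0 ≤ u ∧ CoverRate p E 0 0 u} with hy
  have hy1 := u0le ⟨homographyValue_nonneg _ u0, hcov y u0 u0c⟩
  -- The cap `c / a + d / b` bounds the homography on nonnegative reals, so the image of `z` is an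
  -- admissible competitor of `z`.
  obtain ⟨z, ⟨z0, -, zp⟩, zle⟩ := PackRate.exists_isGreatest (p := p) (A := E) (k := 0)
    (b := (c : ℝ) / a + d / b) (by positivity)
  have hz1 := zle ⟨homographyValue_nonneg _ z0, by
    have hD : 0 < (a : ℝ) + b * z := by positivity
    simp only [homographyValue]
    rw [add_div]
    refine add_le_add (div_le_div_of_nonneg_left hc.le ha (by nlinarith)) ?_
    rw [div_le_div_iff₀ hD hb]
    nlinarith, hpack z z0 zp⟩
  simp only [homographyValue] at hy1 hz1
  rw [le_div_iff₀ (by positivity)] at hy1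
  rw [div_le_iff₀ (by positivity)] at hz1
  have hdisc : 0 ≤ ((a : ℝ) - d) ^ 2 + 4 * b * c := by positivity
  set s := Real.sqrt (((a : ℝ) - d) ^ 2 + 4 * b * c) with hs
  have hss : s ^ 2 = ((a : ℝ) - d) ^ 2 + 4 * b * c := Real.sq_sqrt hdisc
  have hsa : (a : ℝ) - d < s := by
    refine lt_of_le_of_lt (le_abs_self _) ?_
    rw [← Real.sqrt_sq_eq_abs, hs]
    refine Real.sqrt_lt_sqrt (sq_nonneg _) ?_
    have : 0 < 4 * (b : ℝ) * c := by positivity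
    linarith
  -- The positive root of `b u² + (a - d) u - c`, the fixed-point equation.
  set u : ℝ := (s - (a - d)) / (2 * b) with hu
  have hu0 : 0 < u := div_pos (by linarith) (by linarith)
  have hub : 2 * b * u + (a - d) = s := by rw [hu]; field_simp; ring
  have hroot : b * u ^ 2 + (a - d) * u - c = 0 := by
    have : 4 * (b : ℝ) * (b * u ^ 2 + (a - d) * u - c) = 0 := by
      rw [← hub] at hss
      linear_combination hss
    exact (mul_eq_zero.1 this).resolve_left (by positivity)
  have hyu : y ≤ u := by
    by_contra hlt
    push Not at hlt
    -- Eliminating `a - d` between `y ≤ F y` and `F u = u` gives `(b y u + c) (y - u) ≤ 0`.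
    have f1 : 0 < b * (y * u) * (y - u) + c * (y - u) := by
      have : 0 < y := hu0.trans hlt
      have : 0 < y - u := by linarith
      positivity
    have f2 : (y * (a + b * y)) * u ≤ (c + d * y) * u := mul_le_mul_of_nonneg_right hy1 hu0.le
    have f3 : y * (b * u ^ 2 + (a - d) * u - c) = 0 := by rw [hroot, mul_zero]
    nlinarith
  have huz : u ≤ z := by
    by_contra hlt
    push Not at hlt
    have f1 : 0 < b * (z * u) * (u - z) + c * (u - z) := by
      have : 0 < u - z := by linarith
      positivity
    have f2 : (c + d * z) * u ≤ (z * (a + b * z)) * u := mul_le_mul_of_nonneg_right hz1 hu0.le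
    have f3 : z * (b * u ^ 2 + (a - d) * u - c) = 0 := by rw [hroot, mul_zero]
    nlinarith
  refine ⟨1 / u, isValuativeCapacity_of_rates hu0 (u0c.anti subset_rfl hyu)
    (zp.mono subset_rfl huz), ?_⟩
  field_simp
  linear_combination -hroot

theorem mainTheorem5 :
    ∃ q : ℕ × ℕ × List ℕ → Polynomial ℚ,
      (∀ i : ℕ, ComputableRat (fun d : ℕ × ℕ × List ℕ => (q d).coeff i)) ∧
      ∀ (p m : ℕ) (S : List ℕ), p.Prime → 1 ≤ m → S ≠ [] → (∀ c ∈ S, ¬ p ^ m ∣ c) →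
        (q (p, m, S)).natDegree = 2 ∧
        ∀ E E' : Set ℤ, E' = cosetUnion (p ^ m) S →
          E = E' ∪ (fun x : ℤ => (p : ℤ) ^ m * x) '' E →
          ∃ L : ℝ, IsValuativeCapacity p E L ∧ Polynomial.aeval L (q (p, m, S)) = 0 := by
  refine ⟨capacityPolynomial, computableRat_coeff_capacityPolynomial, ?_⟩
  intro p m S hp hm hS0 hS
  have : Fact p.Prime := ⟨hp⟩
  have h := isSpine_rootHomography hS
  have hb := h.b_pos hm
  -- Modulo `p ^ 0` every element of `S` is in the zero class, so a non-empty `S` makes the leading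
  -- coefficient nonzero.
  have hc : 0 < (rootHomography (p, m, S)).1.1 := by
    obtain ⟨c, hc⟩ := List.exists_mem_of_ne_nil S hS0
    exact h.c_pos ⟨c, hc, by simp [residueClass]⟩
  refine ⟨Polynomial.natDegree_quadratic (by exact_mod_cast hc.ne'), ?_⟩
  rintro E _ rfl hE
  obtain ⟨L, hL, hroot⟩ := exists_isValuativeCapacity h hb hc hE
  refine ⟨L, hL, ?_⟩
  rw [← hroot]
  simp [capacityPolynomial]
  ring
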